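/- For $x\in M(n)=\mathbb{C}^{n\times n}$ let $x_m$ be its leading principal $m\times m$ submatrix and $E(x_m)$ the multiset of eigenvalues of $x_m$. For $1\le m\le n$ fix an ordered list $\mu^{(m)}_1,\dots,\mu^{(m)}_m$ of complex numbers, and assume that the list is generic: for every $m\le n$ the $\mu^{(m)}_l$ are distinct, and for every $m<n$ no $\mu^{(m)}_i$ equals any $\mu^{(m+1)}_k$. Let $$M_{\mathcal R}(n)=\{x\in M(n): E(x_m)=\{\mu^{(m)}_1,\dots,\mu^{(m)}_m\},\ 1\le m\le n\}$$ be the corresponding fibre and $\Lambda_m=\operatorname{diag}(\mu^{(m)}_1,\dots,\mu^{(m)}_m)$. *Flows.* Let $\alpha_{ij}(x)=x_{ij}$ and let $\{f,g\}=\sum_{ij,kl}\{\alpha_{ij},\alpha_{kl}\}\frac{\partial f}{\partial\alpha_{ij}}\frac{\partial g}{\partial\alpha_{kl}}$ be the Poisson bracket with $\{\alpha_{ij},\alpha_{kl}\}=\delta_{jk}\alpha_{il}-\delta_{il}\alpha_{kj}$. The Hamiltonian vector field of $H$ is $\{H,\cdot\}$. For $j=\binom m2+l$ with $1\le m\le n-1$,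 $1\le l\le m$, let $\eta_j$ be the vector field on $M_{\mathcal R}(n)$ whose value at $x$ is the Hamiltonian vector field at $x$ of the Ritz value $\mu^{(m)}_l$, that is, of the local holomorphic branch near $x$ of the eigenvalue of $z\mapsto z_m$ which equals $\mu^{(m)}_l$ at $x$. Let $\exp(t\eta_j)\cdot x$, $t\in\mathbb{C}$, be its flow on the fibre: $\phi(t)=\exp(t\eta_j)\cdot x$ satisfies $\phi(0)=x$, $\phi(t)\in M_{\mathcal R}(n)$ and $\phi'(t)=\eta_j(\phi(t))$. *Kostant–Wallach coordinates.* Let $y$ be the unit upper Hessenberg matrix in $M_{\mathcal R}(n)$ ($y_{ik}=0$ for $i>k+1$ and $y_{i+1,i}=1$). Numbers $s=(s_j)_{1\le j\le\binom n2}$, grouped as $s=(s^{(1)},\dots,s^{(n-1)})$ with $s^{(m)}=(s_j)_{\binom m2<j\le\binom{m+1}2}$, are the Kostant–Wallach coordinates of $x$ if $x=\exp(q_1\eta_1)\cdots\exp(q_{\binom n2}\eta_{\binom n2})\cdot y$ and $s_j=e^{-q_j}$ for some $q_j\in\mathbb{C}$. *Arrow coordinates.* For $1\le m\le n-1$, the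 row $b_m^T$ is the row of arrow coordinates of $x\in M_{\mathcal R}(n)$ at level $m$ if $$x_{m+1}=\begin{pmatrix}g_m&0\\0&1\end{pmatrix}\begin{pmatrix}\Lambda_m&c_m\\ b_m^T&\delta_{m+1}\end{pmatrix}\begin{pmatrix}g_m^{-1}&0\\0&1\end{pmatrix}$$ for some $c_m\in\mathbb{C}^m$, $\delta_{m+1}\in\mathbb{C}$, where $g_m\in GL(m)$ satisfies $x_m=g_m\Lambda_mg_m^{-1}$ and has last row $(1,\dots,1)$. **Claim.** The matrix $y$ exists and is unique; the flows $\exp(t\eta_j)\cdot x$ exist for all $t\in\mathbb{C}$ and $x\in M_{\mathcal R}(n)$ and are unique; and every $x\in M_{\mathcal R}(n)$ has exactly one system $s$ of Kostant–Wallach coordinates. These coincide with the arrow coordinates: for every $x\in M_{\mathcal R}(n)$ and every $s$, $s$ is the system of Kostant–Wallach coordinates of $x$ if and only if, for all $1\le m\le n-1$, $s^{(m)}$ is the row $b_m^T$ of arrow coordinates of $x$ at level $m$. Concretely, for all $q_j\in\mathbb{C}$, if $$x=\tilde a(1)\cdots\tilde a(n-1)\cdot y,\qquad \tilde a(m)=\prod_{\binom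 m2<j\le\binom{m+1}2}\exp(-q_j\eta_j),$$ then $x\in M_{\mathcal R}(n)$, and for $1\le m\le n-1$ the arrow form of $x_{m+1}$ holds with $b_m^T=\bigl(e^{q_{\binom m2+1}},\dots,e^{q_{\binom{m+1}2}}\bigr)$. -/

import Mathlib

namespace GZ

open Topology

noncomputable section

/-- The algebra `M(n)` of complex `n × n` matrices. -/
abbrev M (n : ℕ) : Type := Matrix (Fin n) (Fin n) ℂ

-- Any norm would do for the notions of derivative below: `M n` is finite dimensional.
attribute [local instance] Matrix.normedAddCommGroup Matrix.normedSpace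

/-- The leading principal submatrix `x_m` of order `m ≤ n`. -/
def leading {n : ℕ} (x : M n) (m : ℕ) (h : m ≤ n) : M m :=
  x.submatrix (Fin.castLE h) (Fin.castLE h)

/-- The multiset `E(x)` of eigenvalues, with algebraic multiplicity. -/
def E {m : ℕ} (x : M m) : Multiset ℂ := x.charpoly.roots

/-- The fibre `M_R(n)`: all matrices whose Ritz values are those listed by `μ`, where
`μ m : Fin m → ℂ` is a chosen ordering of the prescribed eigenvalues of `x_m`.
Only the values `μ m` with `m ≤ n` matter. -/
def fibre (n : ℕ) (μ : (m : ℕ) → Fin m → ℂ) : Set (M n) :=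
  {x | ∀ (m : ℕ) (h : m ≤ n), E (leading x m h) = Finset.univ.val.map (μ m)}

/-- The eigenvalue disjointness conditions: the prescribed eigenvalues of each `x_m` are
distinct, and those of `x_m` and `x_{m+1}` are disjoint. -/
structure IsGeneric (n : ℕ) (μ : (m : ℕ) → Fin m → ℂ) : Prop where
  distinct : ∀ m : ℕ, m ≤ n → Function.Injective (μ m)
  disjoint : ∀ m : ℕ, m + 1 ≤ n → ∀ (i : Fin m) (j : Fin (m + 1)), μ m i ≠ μ (m + 1) j

/-- Unit upper Hessenberg matrices. -/
def IsUnitUpperHessenberg {n : ℕ} (y : M n) : Prop :=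
  (∀ i j : Fin n, (j : ℕ) + 1 < (i : ℕ) → y i j = 0) ∧
    ∀ i j : Fin n, (i : ℕ) = (j : ℕ) + 1 → y i j = 1

/-! ### The Poisson structure and the flows attached to the Ritz values -/

/-- The partial derivative `∂f/∂α_{ij}` at `x`, where `α_{ij}` is the `(i,j)` entry. -/
def partialDeriv {n : ℕ} (f : M n → ℂ) (i j : Fin n) (x : M n) : ℂ :=
  fderiv ℂ f x (Matrix.single i j 1)

/-- `{α_{ij}, α_{kl}} = δ_{jk} α_{il} - δ_{il} α_{kj}`, evaluated at `x`. -/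
def coordBracket {n : ℕ} (i j k l : Fin n) (x : M n) : ℂ :=
  (if j = k then x i l else 0) - (if i = l then x k j else 0)

/-- The Poisson bracket on `M(n)`. -/
def poissonBracket {n : ℕ} (f g : M n → ℂ) (x : M n) : ℂ :=
  ∑ i, ∑ j, ∑ k, ∑ l, coordBracket i j k l x * partialDeriv f i j x * partialDeriv g k l x

/-- The Hamiltonian vector field `ξ_H = {H, ·}`, as a matrix-valued function. -/
def hamiltonianField {n : ℕ} (H : M n → ℂ) (x : M n) : M n :=
  Matrix.of fun k l => poissonBracket H (fun z => z k l) x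

/-- `ρ` is, near `x`, a holomorphic branch of the eigenvalue of the order-`m` leading principal
submatrix that takes the value `lam` at `x`. -/
def IsRitzBranch {n : ℕ} (x : M n) (m : ℕ) (h : m ≤ n) (lam : ℂ) (ρ : M n → ℂ) : Prop :=
  AnalyticAt ℂ ρ x ∧ ρ x = lam ∧ ∀ᶠ z in 𝓝 x, (leading z m h).charpoly.IsRoot (ρ z)

/-- The vector field `η_j` on a generic fibre, for the index `j = (m choose 2) + (l + 1)` (here
`l : Fin m` is counted from zero): the Hamiltonian vector field of the Ritz value `μ m l`,
regarded as a function of the matrix. As the eigenvalue is simple, the germ of the branch at `x`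
is unique. -/
def ritzField {n : ℕ} (μ : (m : ℕ) → Fin m → ℂ) (m : Fin n) (l : Fin m) (x : M n) : M n :=
  hamiltonianField (Classical.epsilon (IsRitzBranch x m m.isLt.le (μ m l))) x

/-- `φ` is an integral curve (with complex time) of `η_j` in the fibre, starting at `x`. -/
def IsIntegralCurve {n : ℕ} (μ : (m : ℕ) → Fin m → ℂ) (m : Fin n) (l : Fin m) (x : M n)
    (φ : ℂ → M n) : Prop :=
  φ 0 = x ∧ ∀ t, φ t ∈ fibre n μ ∧ HasDerivAt φ (ritzField μ m l (φ t)) t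

/-- The flow `exp(t η_j) · x`. -/
def flow {n : ℕ} (μ : (m : ℕ) → Fin m → ℂ) (m : Fin n) (l : Fin m) (t : ℂ) (x : M n) : M n :=
  Classical.epsilon (IsIntegralCurve μ m l x) t

/-- `a(m) · x`, where `a(m)` is the product of the `exp(q_j η_j)` over the indices `j` that belong
to the eigenvalues of `x_m`. -/
def blockAct {n : ℕ} (μ : (m : ℕ) → Fin m → ℂ) (q : (m : Fin n) → Fin m → ℂ) (m : Fin n)
    (x : M n) : M n :=
  (List.finRange m).foldr (fun l z => flow μ m l (q m l) z) x

/-- `a(1) ⋯ a(n-1) · x = exp(q_1 η_1) exp(q_2 η_2) ⋯ · x` (the block `m = 0` is empty). -/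
def act {n : ℕ} (μ : (m : ℕ) → Fin m → ℂ) (q : (m : Fin n) → Fin m → ℂ) (x : M n) : M n :=
  (List.finRange n).foldr (fun m z => blockAct μ q m z) x

/-- `s = (s^{(1)}, …, s^{(n-1)})` are the Kostant–Wallach coordinates of `x`: with `y` the unit
upper Hessenberg matrix of the fibre, `x = exp(q_1 η_1) exp(q_2 η_2) ⋯ · y` and
`s_j = exp(-q_j)`. -/
def IsKWCoord {n : ℕ} (μ : (m : ℕ) → Fin m → ℂ) (x : M n) (s : (m : Fin n) → Fin m → ℂ) : Prop :=
  ∃ y ∈ fibre n μ, IsUnitUpperHessenberg y ∧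
    ∃ q : (m : Fin n) → Fin m → ℂ, x = act μ q y ∧ ∀ m l, s m l = Complex.exp (-q m l)

/-! ### Arrow coordinates -/

/-- `g` diagonalizes `x_m` as `x_m = g Λ_m g⁻¹` and has last row `(1, …, 1)`. -/
def IsEigenFrame {m : ℕ} (xm : M m) (lam : Fin m → ℂ) (g : M m) : Prop :=
  IsUnit g ∧ xm = g * Matrix.diagonal lam * g⁻¹ ∧
    ∀ i : Fin m, (i : ℕ) + 1 = m → ∀ l, g i l = 1

/-- The block matrix with rows `(A, c)` and `(bᵀ, δ)`. -/
def bordered {m : ℕ} (A : M m) (c b : Fin m → ℂ) (δ : ℂ) : M (m + 1) :=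
  Matrix.reindex finSumFinEquiv finSumFinEquiv
    (Matrix.fromBlocks A (Matrix.of fun i (_ : Fin 1) => c i)
      (Matrix.of fun (_ : Fin 1) j => b j) (Matrix.of fun (_ _ : Fin 1) => δ))

/-- `b` is the row `b_mᵀ` of arrow coordinates in the arrow form
`x_{m+1} = (g_m ⊕ 1) (Λ_m, c_m; b_mᵀ, δ_{m+1}) (g_m⁻¹ ⊕ 1)`. -/
def IsArrowCoord {n : ℕ} (μ : (m : ℕ) → Fin m → ℂ) (x : M n) (m : Fin n) (b : Fin m → ℂ) : Prop :=
  ∃ g : M m, IsEigenFrame (leading x m m.isLt.le) (μ m) g ∧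
    ∃ (c : Fin m → ℂ) (δ : ℂ),
      leading x (m + 1) m.isLt =
        bordered g 0 0 1 * bordered (Matrix.diagonal (μ m)) c b δ * bordered g⁻¹ 0 0 1

end

end GZ

/-! By genericity each `x_m` has a unique eigenframe `g_m` with last row of ones. Since the Ritz
value `μ^{(m)}_l` is a simple eigenvalue, its gradient for the trace form is the spectral projection
`P = g_m e_ll g_m⁻¹`, padded by zeros, so that its Hamiltonian field is the commutator `[P, x]`
(`ritzField_eq`). As `P` commutes with `x_m`, the flow leaves `x_m` fixed, hence also `P`; the flow
is therefore conjugation by `exp(tP) = 1 + (e^t - 1)P`, defined for all complex times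
(`IsIntegralCurve.eq_conjFlow`).

The arrow row at level `m` is the last row of `x_{m+1}`, without its diagonal entry, times `g_m`.
The conjugation multiplies the coordinate `(m, l)` by `e^{-t}` and changes no other
(`isArrowCoord_flow`).

The spectrum of `x_{m+1}` fixes the products `b_l c_l` and the corner `δ`, and disjointness of
spectra forces `b_l ≠ 0`. So the arrow coordinates determine a point of the fibre
(`eq_of_isArrowCoord`). The unit upper Hessenberg point is the one whose coordinates all equal `1`
(`isUnitUpperHessenberg_iff`). Flowing from it for times `q_j` yields the coordinates `e^{-q_j}`,
and every nonzero value is of this form. -/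

namespace GZ

open Topology Matrix Polynomial

noncomputable section

/-! ### Leading submatrices and their embeddings -/

/-- The `m × n` matrix of the projection onto the first `m` coordinates. -/
def incl {m n : ℕ} (h : m ≤ n) : Matrix (Fin m) (Fin n) ℂ :=
  Matrix.of fun a i => if Fin.castLE h a = i then 1 else 0

/-- Extension of an `m × m` matrix by zeros to an `n × n` matrix. -/
def pad {m n : ℕ} (h : m ≤ n) (P : M m) : M n := (incl h)ᵀ * P * incl h

lemma incl_mul {m n : ℕ} (h : m ≤ n) {p : Type*} (x : Matrix (Fin n) p ℂ) :
    incl h * x = x.submatrix (Fin.castLE h) id := by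
  ext i j; simp [incl, Matrix.mul_apply]

lemma mul_incl_transpose {m n : ℕ} (h : m ≤ n) {p : Type*} (x : Matrix p (Fin n) ℂ) :
    x * (incl h)ᵀ = x.submatrix id (Fin.castLE h) := by
  ext i j; simp [incl, Matrix.mul_apply]

lemma incl_mul_transpose {m n : ℕ} (h : m ≤ n) : incl h * (incl h)ᵀ = 1 := by
  rw [incl_mul]
  ext i j
  simp [incl, Matrix.one_apply, Fin.ext_iff, eq_comm]

lemma incl_mul_incl {m k n : ℕ} (h : m ≤ k) (h' : k ≤ n) :
    incl h * incl h' = incl (h.trans h') := by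
  rw [incl_mul]
  ext i j
  simp [incl]

lemma incl_refl (m : ℕ) : incl (le_refl m) = 1 := by
  ext i j
  simp [incl, Matrix.one_apply]

lemma leading_eq {m n : ℕ} (h : m ≤ n) (x : M n) : leading x m h = incl h * x * (incl h)ᵀ := by
  rw [incl_mul, mul_incl_transpose]; rfl

lemma leading_leading {m k n : ℕ} (h : m ≤ k) (h' : k ≤ n) (x : M n) :
    leading (leading x k h') m h = leading x m (h.trans h') := rfl

lemma leading_self {n : ℕ} (x : M n) : leading x n le_rfl = x := rfl

lemma pad_refl {m : ℕ} (P : M m) : pad le_rfl P = P := by simp [pad, incl_refl]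

lemma pad_mul_pad {m n : ℕ} (h : m ≤ n) (P Q : M m) : pad h P * pad h Q = pad h (P * Q) := by
  calc pad h P * pad h Q = (incl h)ᵀ * P * (incl h * (incl h)ᵀ) * Q * incl h := by
        simp only [pad, Matrix.mul_assoc]
    _ = pad h (P * Q) := by simp [incl_mul_transpose, pad, Matrix.mul_assoc]

/-- Padding is compatible with restriction to the first `k ≥ m` coordinates. Hence conjugation by a
padded matrix of order `m` descends to every `x_k` with `k ≥ m`. -/
lemma incl_mul_pad {m k n : ℕ} (h : m ≤ k) (h' : k ≤ n) (P : M m) :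
    incl h' * pad (h.trans h') P = pad h P * incl h' := by
  simp only [pad, ← incl_mul_incl h h', Matrix.transpose_mul, ← Matrix.mul_assoc,
    incl_mul_transpose, Matrix.one_mul]

lemma pad_mul_incl_transpose {m k n : ℕ} (h : m ≤ k) (h' : k ≤ n) (P : M m) :
    pad (h.trans h') P * (incl h')ᵀ = (incl h')ᵀ * pad h P := by
  simp only [pad, ← incl_mul_incl h h', Matrix.transpose_mul, Matrix.mul_assoc,
    incl_mul_transpose, Matrix.mul_one]

lemma trace_pad_mul {m n : ℕ} (h : m ≤ n) (P : M m) (Z : M n) :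
    (pad h P * Z).trace = (P * leading Z m h).trace := by
  rw [pad, leading_eq, Matrix.mul_assoc, Matrix.mul_assoc, Matrix.trace_mul_comm]
  simp only [Matrix.mul_assoc]

lemma pad_apply_of_le {m n : ℕ} (h : m ≤ n) (P : M m) (i j : Fin n) (hi : m ≤ i) :
    pad h P i j = 0 := by
  rw [pad, Matrix.mul_assoc, Matrix.mul_apply]
  refine Finset.sum_eq_zero fun a _ => ?_
  have : Fin.castLE h a ≠ i := by
    intro e; have := congrArg Fin.val e; simp at this; omega
  simp [incl, this]

/-! ### Dilations along an idempotent -/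

/-- The matrix that scales the range of an idempotent `P` by `a` and fixes its kernel. -/
def dil {n : ℕ} (a : ℂ) (P : M n) : M n := 1 + (a - 1) • P

lemma dil_one {n : ℕ} (P : M n) : dil 1 P = 1 := by simp [dil]

lemma dil_mul_dil {n : ℕ} (a b : ℂ) {P : M n} (hP : P * P = P) :
    dil a P * dil b P = dil (a * b) P := by
  simp only [dil, Matrix.mul_add, Matrix.add_mul, Matrix.one_mul, Matrix.mul_one,
    Matrix.smul_mul, Matrix.mul_smul, hP]
  module

lemma dil_commute {n : ℕ} (a : ℂ) {P x : M n} (h : Commute P x) : Commute (dil a P) x :=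
  (Commute.one_left x).add_left (h.smul_left _)

lemma dil_mul_self {n : ℕ} (a : ℂ) {P : M n} (hP : P * P = P) : dil a P * P = a • P := by
  simp only [dil, Matrix.add_mul, Matrix.one_mul, Matrix.smul_mul, hP]
  module

lemma self_mul_dil {n : ℕ} (a : ℂ) {P : M n} (hP : P * P = P) : P * dil a P = a • P := by
  simp only [dil, Matrix.mul_add, Matrix.mul_one, Matrix.mul_smul, hP]
  module

lemma incl_mul_dil {m k n : ℕ} (h : m ≤ k) (h' : k ≤ n) (a : ℂ) (P : M m) :
    incl h' * dil a (pad (h.trans h') P) = dil a (pad h P) * incl h' := by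
  simp [dil, Matrix.mul_add, Matrix.add_mul, incl_mul_pad h h']

lemma dil_mul_incl_transpose {m k n : ℕ} (h : m ≤ k) (h' : k ≤ n) (a : ℂ) (P : M m) :
    dil a (pad (h.trans h') P) * (incl h')ᵀ = (incl h')ᵀ * dil a (pad h P) := by
  simp [dil, Matrix.mul_add, Matrix.add_mul, pad_mul_incl_transpose h h']

lemma leading_dil_mul_dil {m k n : ℕ} (h : m ≤ k) (h' : k ≤ n) (a b : ℂ) (P : M m) (x : M n) :
    leading (dil a (pad (h.trans h') P) * x * dil b (pad (h.trans h') P)) k h' =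
      dil a (pad h P) * leading x k h' * dil b (pad h P) := by
  rw [leading_eq, leading_eq]
  calc incl h' * (dil a (pad (h.trans h') P) * x * dil b (pad (h.trans h') P)) * (incl h')ᵀ
      = (incl h' * dil a (pad (h.trans h') P)) * x * (dil b (pad (h.trans h') P) * (incl h')ᵀ) := by
        simp only [Matrix.mul_assoc]
    _ = _ := by
        rw [incl_mul_dil h, dil_mul_incl_transpose h]
        simp only [Matrix.mul_assoc]

lemma dil_pad_mul_apply_of_le {m n : ℕ} (h : m ≤ n) (a : ℂ) (P : M m) {p : Type*}
    (x : Matrix (Fin n) p ℂ) (i : Fin n) (j : p) (hi : m ≤ i) :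
    (dil a (pad h P) * x) i j = x i j := by
  simp only [dil, Matrix.add_mul, Matrix.one_mul, Matrix.smul_mul, Matrix.add_apply,
    Matrix.smul_apply]
  have : (pad h P * x) i j = 0 := by
    rw [Matrix.mul_apply]
    exact Finset.sum_eq_zero fun k _ => by rw [pad_apply_of_le h P i k hi, zero_mul]
  simp [this]

lemma charpoly_conj {n : ℕ} {A B : M n} (h : B * A = 1) (x : M n) :
    (A * x * B).charpoly = x.charpoly := by
  rw [Matrix.charpoly_mul_comm, ← Matrix.mul_assoc, h, Matrix.one_mul]

/-! ### Bordered matrices -/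

lemma bordered_injective {m : ℕ} {A A' : M m} {c c' b b' : Fin m → ℂ} {δ δ' : ℂ}
    (h : bordered A c b δ = bordered A' c' b' δ') : A = A' ∧ c = c' ∧ b = b' ∧ δ = δ' := by
  have h := (Matrix.reindex finSumFinEquiv finSumFinEquiv).injective h
  rw [Matrix.fromBlocks_inj] at h
  obtain ⟨h1, h2, h3, h4⟩ := h
  exact ⟨h1, funext fun i => congrFun (congrFun h2 i) 0, funext fun i => congrFun (congrFun h3 0) i,
    congrFun (congrFun h4 0) 0⟩

lemma bordered_mul_mul {m : ℕ} (g A h : M m) (c b : Fin m → ℂ) (δ : ℂ) :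
    bordered g 0 0 1 * bordered A c b δ * bordered h 0 0 1 =
      bordered (g * A * h) (g *ᵥ c) (b ᵥ* h) δ := by
  simp only [bordered, Matrix.reindex_apply, Matrix.submatrix_mul_equiv, Matrix.fromBlocks_multiply]
  congr 1
  ext (i | i) (j | j) <;>
    simp [Matrix.mul_apply, Matrix.mulVec, Matrix.vecMul, dotProduct]

/-- The last row of `x_{m+1}`, without its diagonal entry. -/
def lastRow {n : ℕ} (x : M n) (m : Fin n) : Fin m → ℂ := fun i => x m (Fin.castLE m.isLt.le i)

lemma leading_succ {n : ℕ} (x : M n) (m : Fin n) :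
    leading x (m + 1) m.isLt = bordered (leading x m m.isLt.le)
      (fun i => x (Fin.castLE m.isLt.le i) m) (lastRow x m) (x m m) := by
  ext i j
  obtain ⟨i, rfl⟩ := finSumFinEquiv.surjective i
  obtain ⟨j, rfl⟩ := finSumFinEquiv.surjective j
  simp only [bordered, Matrix.reindex_apply, Matrix.submatrix_apply, Equiv.symm_apply_apply]
  rcases i with i | i <;> rcases j with j | j <;>
    simp only [leading, lastRow, Matrix.fromBlocks_apply₁₁, Matrix.fromBlocks_apply₁₂,
      Matrix.fromBlocks_apply₂₁, Matrix.fromBlocks_apply₂₂, Matrix.of_apply, Matrix.submatrix_apply,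
      finSumFinEquiv_apply_left, finSumFinEquiv_apply_right]
  all_goals
    congr 1
    all_goals
      ext
      simp

lemma leading_bordered {m : ℕ} (A : M m) (c b : Fin m → ℂ) (δ : ℂ) :
    leading (bordered A c b δ) m (Nat.le_succ m) = A :=
  ((bordered_injective (leading_succ (bordered A c b δ) (Fin.last m))).1).symm

/-- Two polynomials that agree off the finite set of the `lam k` coincide; there `z - Λ` is
invertible and the determinant is given by its Schur complement. -/
lemma charpoly_bordered_diagonal {m : ℕ} (lam c b : Fin m → ℂ) (δ : ℂ) :
    (bordered (diagonal lam) c b δ).charpoly =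
      (∏ k, (X - C (lam k))) * (X - C δ) -
        ∑ l, C (b l * c l) * ∏ k ∈ Finset.univ.erase l, (X - C (lam k)) := by
  refine Polynomial.eq_of_infinite_eval_eq _ _
    (((Set.finite_range lam).infinite_compl).mono fun z hz => ?_)
  have hz' : ∀ k, z - lam k ≠ 0 := fun k h => hz ⟨k, (sub_eq_zero.1 h).symm⟩
  let D : M m := diagonal fun k => z - lam k
  have hD : D * diagonal (fun k => (z - lam k)⁻¹) = 1 := by
    simp [D, diagonal_mul_diagonal, hz']
  have hD' : diagonal (fun k => (z - lam k)⁻¹) * D = 1 := by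
    simp [D, diagonal_mul_diagonal, hz']
  let _ : Invertible D := ⟨_, hD', hD⟩
  have key : (scalar (Fin m ⊕ Fin 1) z - fromBlocks (diagonal lam) (of fun i (_ : Fin 1) => c i)
      (of fun (_ : Fin 1) j => b j) (of fun (_ _ : Fin 1) => δ)) =
      fromBlocks D (of fun i (_ : Fin 1) => -c i)
      (of fun (_ : Fin 1) j => -b j) (of fun (_ _ : Fin 1) => z - δ) := by
    ext (i | i) (j | j)
    · by_cases h : i = j <;> simp [D, h]
    · simp
    · simp
    · have : i = j := Subsingleton.elim _ _
      simp [this]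
  have hinv : ⅟D = diagonal (fun k => (z - lam k)⁻¹) := rfl
  rw [Set.mem_ofPred_eq, bordered, Matrix.charpoly_reindex, Matrix.eval_charpoly, key,
    Matrix.det_fromBlocks₁₁, hinv, Matrix.det_fin_one]
  simp only [D, Matrix.det_diagonal, Matrix.sub_apply, Matrix.of_apply,
    Matrix.mul_apply (M := _ * _), Matrix.mul_diagonal, eval_sub, eval_mul, eval_prod, eval_X, eval_C, eval_finsetSum,
    mul_sub, Finset.mul_sum]
  congr 1
  refine Finset.sum_congr rfl fun l _ => ?_
  rw [← Finset.mul_prod_erase Finset.univ (fun k => z - lam k) (Finset.mem_univ l)]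
  have := hz' l
  field_simp

/-- At a node only one summand survives, so the spectrum of an arrow matrix determines each product
`b l * c l` when the nodes are distinct. -/
lemma eval_charpoly_bordered_diagonal {m : ℕ} (lam c b : Fin m → ℂ) (δ : ℂ) (l : Fin m) :
    (bordered (diagonal lam) c b δ).charpoly.eval (lam l) =
      -(b l * c l * ∏ k ∈ Finset.univ.erase l, (lam l - lam k)) := by
  rw [charpoly_bordered_diagonal]
  simp only [eval_sub, eval_mul, eval_prod, eval_X, eval_C, eval_finsetSum]
  rw [Finset.prod_eq_zero (Finset.mem_univ l) (sub_self _), zero_mul, zero_sub,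
    Finset.sum_eq_single l]
  · intro j _ hj
    rw [Finset.prod_eq_zero (Finset.mem_erase.2 ⟨hj.symm, Finset.mem_univ l⟩) (sub_self _), mul_zero]
  · simp

lemma trace_bordered_diagonal {m : ℕ} (lam c b : Fin m → ℂ) (δ : ℂ) :
    (bordered (diagonal lam) c b δ).trace = ∑ k, lam k + δ := by
  rw [Matrix.trace, ← finSumFinEquiv.sum_comp]
  simp [bordered]

lemma prod_erase_sub_ne_zero {m : ℕ} {lam : Fin m → ℂ} (h : Function.Injective lam) (l : Fin m) :
    ∏ k ∈ Finset.univ.erase l, (lam l - lam k) ≠ 0 :=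
  Finset.prod_ne_zero_iff.2 fun _ hk => sub_ne_zero.2 (h.ne (Finset.ne_of_mem_erase hk).symm)

/-- The multiset of eigenvalues determines the characteristic polynomial. -/
lemma charpoly_of_E {m : ℕ} {x : M m} {lam : Fin m → ℂ} (h : E x = Finset.univ.val.map lam) :
    x.charpoly = ∏ k, (X - C (lam k)) := by
  have h1 := (IsAlgClosed.splits x.charpoly).eq_prod_roots_of_monic x.charpoly_monic
  rw [h1, show x.charpoly.roots = _ from h, Multiset.map_map]
  rfl

lemma E_of_charpoly {m : ℕ} {x : M m} {lam : Fin m → ℂ}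
    (h : x.charpoly = ∏ k, (X - C (lam k))) : E x = Finset.univ.val.map lam := by
  rw [E, h]
  have := Polynomial.roots_multiset_prod_X_sub_C (Finset.univ.val.map lam)
  rwa [Multiset.map_map] at this

lemma eq_of_mulVec_eq_smul {m : ℕ} {x : M m} {lam : Fin m → ℂ} (h : E x = Finset.univ.val.map lam)
    {z : ℂ} {v : Fin m → ℂ} (hv : v ≠ 0) (hx : x *ᵥ v = z • v) : ∃ k, z = lam k := by
  have h0 : (scalar (Fin m) z - x).det = 0 :=
    Matrix.exists_mulVec_eq_zero_iff.1 ⟨v, hv, by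
      rw [Matrix.sub_mulVec, hx]; simp [scalar_apply, ← smul_one_eq_diagonal, Matrix.smul_mulVec]⟩
  rw [← Matrix.eval_charpoly, charpoly_of_E h, eval_prod, Finset.prod_eq_zero_iff] at h0
  obtain ⟨k, _, hk⟩ := h0
  exact ⟨k, by simpa [sub_eq_zero] using hk⟩

lemma exists_mulVec_eq_smul {m : ℕ} {x : M m} {lam : Fin m → ℂ}
    (h : E x = Finset.univ.val.map lam) (l : Fin m) :
    ∃ v : Fin m → ℂ, v ≠ 0 ∧ x *ᵥ v = lam l • v := by
  have h0 : (scalar (Fin m) (lam l) - x).det = 0 := by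
    rw [← Matrix.eval_charpoly, charpoly_of_E h, eval_prod]
    exact Finset.prod_eq_zero (Finset.mem_univ l) (by simp)
  obtain ⟨v, hv, e⟩ := Matrix.exists_mulVec_eq_zero_iff.2 h0
  refine ⟨v, hv, ?_⟩
  rw [Matrix.sub_mulVec, sub_eq_zero] at e
  rw [← e]; simp [scalar_apply, ← smul_one_eq_diagonal, Matrix.smul_mulVec]

/-! ### Eigenframes -/

section Frames

variable {n : ℕ} {μ : (m : ℕ) → Fin m → ℂ}

/-- Truncates an eigenvector with zero last entry to an eigenvector of the next smaller leading
submatrix, which would give the two a common eigenvalue. -/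
lemma leading_succ_mulVec_castSucc {k : ℕ} (x : M (k + 1)) (v : Fin (k + 1) → ℂ)
    (hv : v (Fin.last k) = 0) (i : Fin k) :
    (leading x k (Nat.le_succ k) *ᵥ fun j => v j.castSucc) i = (x *ᵥ v) i.castSucc := by
  simp only [Matrix.mulVec, dotProduct, Fin.sum_univ_castSucc, hv, mul_zero, add_zero]
  rfl

/-- By genericity, an eigenvector of `x_m` has nonzero last entry. -/
lemma eigenvector_last_ne_zero (hμ : IsGeneric n μ) {x : M n} (hx : x ∈ fibre n μ) {m : ℕ}
    (h : m ≤ n) (l : Fin m) {v : Fin m → ℂ} (hv : v ≠ 0)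
    (hxv : leading x m h *ᵥ v = μ m l • v) (i : Fin m) (hi : (i : ℕ) + 1 = m) : v i ≠ 0 := by
  obtain ⟨k, rfl⟩ : ∃ k, m = k + 1 := ⟨i, hi.symm⟩
  obtain rfl : i = Fin.last k := Fin.ext (by simpa using hi)
  intro h0
  have hw : (fun j : Fin k => v j.castSucc) ≠ 0 := fun e => hv <| by
    ext j
    induction j using Fin.lastCases with
    | last => exact h0
    | cast j => exact congrFun e j
  obtain ⟨j, hj⟩ := eq_of_mulVec_eq_smul (hx k ((Nat.le_succ k).trans h)) hw
    (z := μ (k + 1) l) (by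
      ext i
      have := leading_succ_mulVec_castSucc (leading x (k + 1) h) v h0 i
      rw [leading_leading] at this
      rw [this, hxv]
      rfl)
  exact hμ.disjoint k h j l hj.symm

lemma IsEigenFrame.det {m : ℕ} {X : M m} {lam : Fin m → ℂ} {g : M m} (hg : IsEigenFrame X lam g) :
    IsUnit g.det := (Matrix.isUnit_iff_isUnit_det g).1 hg.1

lemma IsEigenFrame.mul_inv {m : ℕ} {X : M m} {lam : Fin m → ℂ} {g : M m}
    (hg : IsEigenFrame X lam g) : g * g⁻¹ = 1 := Matrix.mul_nonsing_inv _ hg.det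

lemma IsEigenFrame.inv_mul {m : ℕ} {X : M m} {lam : Fin m → ℂ} {g : M m}
    (hg : IsEigenFrame X lam g) : g⁻¹ * g = 1 := Matrix.nonsing_inv_mul _ hg.det

lemma IsEigenFrame.mul_eq {m : ℕ} {X : M m} {lam : Fin m → ℂ} {g : M m}
    (hg : IsEigenFrame X lam g) : X * g = g * diagonal lam := by
  rw [hg.2.1, Matrix.mul_assoc, hg.inv_mul, Matrix.mul_one]

/-- Distinct eigenvalues make the eigenvectors independent, and their nonzero last entries can be
scaled to `1`. -/
lemma exists_isEigenFrame (hμ : IsGeneric n μ) {x : M n} (hx : x ∈ fibre n μ) {m : ℕ}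
    (h : m ≤ n) : ∃ g, IsEigenFrame (leading x m h) (μ m) g := by
  have hv : ∀ l, ∃ v : Fin m → ℂ, v ≠ 0 ∧ leading x m h *ᵥ v = μ m l • v ∧
      ∀ i : Fin m, (i : ℕ) + 1 = m → v i = 1 := by
    intro l
    obtain ⟨v, hv0, hv⟩ := exists_mulVec_eq_smul (hx m h) l
    let i₀ : Fin m := ⟨m - 1, by have := l.isLt; omega⟩
    have hi : v i₀ ≠ 0 := eigenvector_last_ne_zero hμ hx h l hv0 hv i₀ (by
      have := l.isLt; simp only [i₀]; omega)
    refine ⟨(v i₀)⁻¹ • v, smul_ne_zero (inv_ne_zero hi) hv0, ?_, fun i hi' => ?_⟩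
    · rw [Matrix.mulVec_smul, hv, smul_comm]
    · obtain rfl : i = i₀ := Fin.ext (by simp only [i₀]; omega)
      simp [hi]
  choose v hv0 hv hv1 using hv
  let g : M m := of fun i l => v l i
  have hg : IsUnit g := by
    rw [← Matrix.linearIndependent_cols_iff_isUnit]
    refine Module.End.eigenvectors_linearIndependent' (Matrix.toLin' (leading x m h)) (μ m)
      (hμ.distinct m h) v fun l => ?_
    rw [Module.End.hasEigenvector_iff, Module.End.mem_eigenspace_iff, Matrix.toLin'_apply]
    exact ⟨hv l, hv0 l⟩
  refine ⟨g, hg, ?_, fun i hi l => hv1 l i hi⟩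
  have hmul : leading x m h * g = g * diagonal (μ m) := by
    ext i l
    rw [Matrix.mul_diagonal]
    have := congrFun (hv l) i
    simp only [Pi.smul_apply, smul_eq_mul] at this
    rw [mul_comm, show g i l = v l i from rfl, ← this]
    rfl
  rw [← hmul, Matrix.mul_assoc, Matrix.mul_nonsing_inv _ ((Matrix.isUnit_iff_isUnit_det g).1 hg),
    Matrix.mul_one]

/-- Two frames differ by a factor commuting with a diagonal matrix with distinct entries. This
factor is diagonal, and the two last rows of ones make it the identity. -/
lemma IsEigenFrame.unique {m : ℕ} {X : M m} {lam : Fin m → ℂ} (hl : Function.Injective lam)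
    {g g' : M m} (hg : IsEigenFrame X lam g) (hg' : IsEigenFrame X lam g') : g = g' := by
  let N := g'⁻¹ * g
  have hgN : g = g' * N := by rw [← Matrix.mul_assoc, hg'.mul_inv, Matrix.one_mul]
  have hcomm : N * diagonal lam = diagonal lam * N := by
    calc N * diagonal lam = g'⁻¹ * (X * g) := by rw [hg.mul_eq, Matrix.mul_assoc]
      _ = g'⁻¹ * (X * g') * N := by simp only [hgN, Matrix.mul_assoc]
      _ = (g'⁻¹ * g') * diagonal lam * N := by rw [hg'.mul_eq]; simp only [Matrix.mul_assoc]
      _ = diagonal lam * N := by rw [hg'.inv_mul, Matrix.one_mul]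
  have hoff : ∀ i j, i ≠ j → N i j = 0 := by
    intro i j hij
    have := congrFun (congrFun hcomm i) j
    rw [Matrix.mul_diagonal, Matrix.diagonal_mul] at this
    have h2 : (lam j - lam i) * N i j = 0 := by linear_combination this
    exact (mul_eq_zero.1 h2).resolve_left (sub_ne_zero.2 (hl.ne hij.symm))
  have hN : N = 1 := by
    ext i j
    by_cases hij : i = j
    · subst hij
      let i₀ : Fin m := ⟨m - 1, by have := i.isLt; omega⟩
      have hi₀ : (i₀ : ℕ) + 1 = m := by have := i.isLt; simp only [i₀]; omega
      have := congrFun (congrFun hgN i₀) i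
      rw [Matrix.mul_apply, Finset.sum_eq_single i (fun k _ hk => by rw [hoff k i hk, mul_zero])
        (by simp), hg.2.2 i₀ hi₀, hg'.2.2 i₀ hi₀, one_mul] at this
      rw [← this, Matrix.one_apply_eq]
    · rw [hoff i j hij, Matrix.one_apply_ne hij]
  rw [hgN, hN, Matrix.mul_one]

/-! ### Spectral projections -/

/-- The projection onto the span of the `l`-th column of `g` along the other columns. -/
def frameProj {m : ℕ} (g : M m) (l : Fin m) : M m := g * single l l 1 * g⁻¹

lemma IsEigenFrame.frameProj_mul_self {m : ℕ} {X : M m} {lam : Fin m → ℂ} {g : M m}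
    (hg : IsEigenFrame X lam g) (l : Fin m) : frameProj g l * frameProj g l = frameProj g l := by
  calc g * single l l 1 * g⁻¹ * (g * single l l 1 * g⁻¹)
      = g * single l l 1 * (g⁻¹ * g) * single l l 1 * g⁻¹ := by simp only [Matrix.mul_assoc]
    _ = g * (single l l 1 * single l l 1) * g⁻¹ := by
        rw [hg.inv_mul, Matrix.mul_one]; simp only [Matrix.mul_assoc]
    _ = _ := by simp [frameProj]

lemma IsEigenFrame.frameProj_mul_frame {m : ℕ} {X : M m} {lam : Fin m → ℂ} {g : M m}
    (hg : IsEigenFrame X lam g) (l : Fin m) : frameProj g l * g = g * single l l 1 := by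
  rw [frameProj, Matrix.mul_assoc, hg.inv_mul, Matrix.mul_one]

lemma IsEigenFrame.commute_frameProj {m : ℕ} {X : M m} {lam : Fin m → ℂ} {g : M m}
    (hg : IsEigenFrame X lam g) (l : Fin m) : Commute (frameProj g l) X := by
  have h : (single l l 1 : M m) * diagonal lam = diagonal lam * single l l 1 := by
    ext i j
    rw [Matrix.mul_diagonal, Matrix.diagonal_mul]
    by_cases h : l = i ∧ l = j
    · obtain ⟨rfl, rfl⟩ := h; ring
    · simp [h]
  calc frameProj g l * X = g * single l l 1 * (g⁻¹ * g) * diagonal lam * g⁻¹ := by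
        rw [hg.2.1]; simp only [frameProj, Matrix.mul_assoc]
    _ = g * (single l l 1 * diagonal lam) * g⁻¹ := by
        rw [hg.inv_mul, Matrix.mul_one]; simp only [Matrix.mul_assoc]
    _ = g * diagonal lam * (g⁻¹ * g) * single l l 1 * g⁻¹ := by
        rw [h, hg.inv_mul, Matrix.mul_one]; simp only [Matrix.mul_assoc]
    _ = X * frameProj g l := by
        conv_rhs => rw [hg.2.1]
        simp only [frameProj, Matrix.mul_assoc]

/-! ### Arrow coordinates -/

/-- Multiplying out the arrow form, the blocks `c` and `δ` can always be solved for; only the bottom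
row imposes a condition on `b`. -/
lemma isArrowCoord_iff_exists (x : M n) (m : Fin n) (b : Fin m → ℂ) :
    IsArrowCoord μ x m b ↔
      ∃ g, IsEigenFrame (leading x m m.isLt.le) (μ m) g ∧ b = lastRow x m ᵥ* g := by
  refine exists_congr fun g => and_congr_right fun hg => ?_
  simp only [bordered_mul_mul, leading_succ x m]
  constructor
  · rintro ⟨c, δ, h⟩
    rw [(bordered_injective h).2.2.1, Matrix.vecMul_vecMul, hg.inv_mul, Matrix.vecMul_one]
  · rintro rfl
    refine ⟨g⁻¹ *ᵥ (fun i => x (Fin.castLE m.isLt.le i) m), x m m, ?_⟩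
    rw [Matrix.mulVec_mulVec, Matrix.vecMul_vecMul, hg.mul_inv, Matrix.one_mulVec,
      Matrix.vecMul_one, ← hg.2.1]

lemma isArrowCoord_iff (hμ : IsGeneric n μ) {x : M n} {m : Fin n} {g : M m}
    (hg : IsEigenFrame (leading x m m.isLt.le) (μ m) g) (b : Fin m → ℂ) :
    IsArrowCoord μ x m b ↔ b = lastRow x m ᵥ* g := by
  rw [isArrowCoord_iff_exists]
  refine ⟨fun ⟨g', hg', h⟩ => ?_, fun h => ⟨g, hg, h⟩⟩
  rwa [hg.unique (hμ.distinct m m.isLt.le) hg']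

lemma IsArrowCoord.unique (hμ : IsGeneric n μ) {x : M n} {m : Fin n} {b b' : Fin m → ℂ}
    (h : IsArrowCoord μ x m b) (h' : IsArrowCoord μ x m b') : b = b' := by
  obtain ⟨g, hg, rfl⟩ := (isArrowCoord_iff_exists x m b).1 h
  exact ((isArrowCoord_iff hμ hg b').1 h').symm

lemma exists_isArrowCoord (hμ : IsGeneric n μ) {x : M n} (hx : x ∈ fibre n μ) (m : Fin n) :
    ∃ b, IsArrowCoord μ x m b := by
  obtain ⟨g, hg⟩ := exists_isEigenFrame hμ hx m.isLt.le
  exact ⟨_, (isArrowCoord_iff hμ hg _).2 rfl⟩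

/-! ### Reconstruction of a matrix from its spectra and arrow coordinates -/

lemma bordered_mul_bordered_eq_one {m : ℕ} {h g : M m} (hg : h * g = 1) :
    bordered h 0 0 1 * bordered g 0 0 1 = 1 := by
  simp only [bordered, Matrix.reindex_apply, Matrix.submatrix_mul_equiv,
    Matrix.fromBlocks_multiply]
  rw [← Matrix.submatrix_one_equiv (finSumFinEquiv (m := m) (n := 1)).symm]
  congr 1
  ext (i | i) (j | j)
  · simpa [Matrix.mul_apply, Matrix.one_apply] using congrFun (congrFun hg i) j
  · simp [Matrix.mul_apply]
  · simp [Matrix.mul_apply]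
  · simp [Matrix.mul_apply, Matrix.one_apply, Subsingleton.elim i j]

/-- The arrow form of `x_{m+1}` has the prescribed spectrum of `x_{m+1}`. -/
lemma charpoly_arrow {x : M n} (hx : x ∈ fibre n μ) {m : Fin n} {lam : Fin m → ℂ} {g : M m}
    (hg : IsEigenFrame (leading x m m.isLt.le) lam g) {c b : Fin m → ℂ} {δ : ℂ}
    (h : leading x (m + 1) m.isLt =
      bordered g 0 0 1 * bordered (diagonal lam) c b δ * bordered g⁻¹ 0 0 1) :
    (bordered (diagonal lam) c b δ).charpoly = ∏ k, (X - C (μ (m + 1) k)) := by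
  rw [← charpoly_of_E (hx _ m.isLt), h, charpoly_conj (bordered_mul_bordered_eq_one hg.inv_mul)]

/-- If `b l` vanished, `μ m l` would be a root of the characteristic polynomial at level `m + 1`,
against disjointness. -/
lemma arrow_mul_ne_zero (hμ : IsGeneric n μ) {m : ℕ} (hm : m + 1 ≤ n) {c b : Fin m → ℂ} {δ : ℂ}
    (h : (bordered (diagonal (μ m)) c b δ).charpoly = ∏ k, (X - C (μ (m + 1) k)))
    (l : Fin m) : b l ≠ 0 := by
  intro h0
  have h1 := eval_charpoly_bordered_diagonal (μ m) c b δ l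
  rw [h, h0, zero_mul, zero_mul, neg_zero, eval_prod, Finset.prod_eq_zero_iff] at h1
  obtain ⟨k, _, hk⟩ := h1
  exact hμ.disjoint m hm l k (by simpa [sub_eq_zero] using hk)

/-- Evaluation at `μ m l` gives `b l * c l` with `b l ≠ 0`, hence `c`; the trace gives `δ`. -/
lemma arrow_unique (hμ : IsGeneric n μ) {m : ℕ} (hm : m + 1 ≤ n) {c c' b : Fin m → ℂ}
    {δ δ' : ℂ} {p : ℂ[X]} (hp : p = ∏ k, (X - C (μ (m + 1) k)))
    (h : (bordered (diagonal (μ m)) c b δ).charpoly = p)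
    (h' : (bordered (diagonal (μ m)) c' b δ').charpoly = p) : c = c' ∧ δ = δ' := by
  constructor
  · ext l
    have h1 := eval_charpoly_bordered_diagonal (μ m) c b δ l
    have h2 := eval_charpoly_bordered_diagonal (μ m) c' b δ' l
    rw [h] at h1
    rw [h', h1, neg_inj] at h2
    exact mul_left_cancel₀ (arrow_mul_ne_zero hμ hm (h.trans hp) l)
      (mul_right_cancel₀ (prod_erase_sub_ne_zero (hμ.distinct m (Nat.le_of_succ_le hm)) l) h2)
  · have h1 := Matrix.trace_eq_sum_roots_charpoly (bordered (diagonal (μ m)) c b δ)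
    have h2 := Matrix.trace_eq_sum_roots_charpoly (bordered (diagonal (μ m)) c' b δ')
    rw [h, trace_bordered_diagonal] at h1
    rw [h', ← h1, trace_bordered_diagonal] at h2
    exact (add_left_cancel h2).symm

lemma IsArrowCoord.ne_zero (hμ : IsGeneric n μ) {x : M n} (hx : x ∈ fibre n μ) {m : Fin n}
    {b : Fin m → ℂ} (h : IsArrowCoord μ x m b) (l : Fin m) : b l ≠ 0 := by
  obtain ⟨g, hg, c, δ, h⟩ := h
  exact arrow_mul_ne_zero hμ m.isLt (charpoly_arrow hx hg h) l

/-- A matrix in the fibre is determined by its arrow coordinates. -/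
lemma eq_of_isArrowCoord (hμ : IsGeneric n μ) {x x' : M n} (hx : x ∈ fibre n μ)
    (hx' : x' ∈ fibre n μ) {s : (m : Fin n) → Fin m → ℂ} (h : ∀ m, IsArrowCoord μ x m (s m))
    (h' : ∀ m, IsArrowCoord μ x' m (s m)) : x = x' := by
  -- Level by level: `x_m` determines the frame, and the frame, the row and the spectrum of
  -- `x_{m+1}` determine `x_{m+1}`.
  have key : ∀ m (hm : m ≤ n), leading x m hm = leading x' m hm := by
    intro m
    induction m with
    | zero => intro _; ext i; exact i.elim0
    | succ m ih =>
      intro hm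
      obtain ⟨g, hg, c, δ, e⟩ := h ⟨m, hm⟩
      obtain ⟨g', hg', c', δ', e'⟩ := h' ⟨m, hm⟩
      have hcp := charpoly_arrow hx hg e
      have hcp' := charpoly_arrow hx' hg' e'
      obtain ⟨rfl, rfl⟩ := arrow_unique hμ hm rfl hcp hcp'
      have hgg : g = g' := by
        refine hg.unique (hμ.distinct m (Nat.le_of_succ_le hm)) ?_
        have := ih (Nat.le_of_succ_le hm)
        simp only at hg' ⊢
        rwa [this]
      subst hgg
      exact e.trans e'.symm
  exact key n le_rfl

/-- There is an arrow matrix with prescribed nonzero row and prescribed spectrum. -/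
lemma exists_arrow (hμ : IsGeneric n μ) {m : ℕ} (hm : m + 1 ≤ n) (b : Fin m → ℂ)
    (hb : ∀ l, b l ≠ 0) : ∃ c δ,
      (bordered (diagonal (μ m)) c b δ).charpoly = ∏ k, (X - C (μ (m + 1) k)) := by
  set p : ℂ[X] := ∏ k, (X - C (μ (m + 1) k)) with hp
  have hpm : p.Monic := monic_prod_of_monic _ _ fun k _ => monic_X_sub_C _
  have hpd : p.natDegree = m + 1 := by simp [hp]
  -- Both choices are forced: `c` by the value at `μ m l`, `δ` by the trace.
  let c : Fin m → ℂ := fun l =>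
    -p.eval (μ m l) / (b l * ∏ k ∈ Finset.univ.erase l, (μ m l - μ m k))
  let δ : ℂ := ∑ k, μ (m + 1) k - ∑ k, μ m k
  refine ⟨c, δ, ?_⟩
  set q := (bordered (diagonal (μ m)) c b δ).charpoly with hq
  have hqm : q.Monic := Matrix.charpoly_monic _
  have hqd : q.natDegree = m + 1 := by simp [hq, Matrix.charpoly_natDegree_eq_dim]
  have hcoeff : q.coeff m = p.coeff m := by
    have h1 := Matrix.trace_eq_neg_charpoly_coeff (bordered (diagonal (μ m)) c b δ)
    rw [trace_bordered_diagonal] at h1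
    have h2 := Polynomial.prod_X_sub_C_coeff_card_pred (Finset.univ) (μ (m + 1)) (by simp)
    simp only [Finset.card_univ, Fintype.card_fin, Nat.add_sub_cancel] at h1 h2
    rw [hp, h2, hq, ← neg_inj, ← h1, neg_neg]
    simp [δ]
  have heval : ∀ l, q.eval (μ m l) = p.eval (μ m l) := by
    intro l
    rw [hq, eval_charpoly_bordered_diagonal]
    have h1 := prod_erase_sub_ne_zero (hμ.distinct m (Nat.le_of_succ_le hm)) l
    have h2 := hb l
    simp only [c]
    field_simp
  -- Both polynomials are monic of degree `m + 1` and the trace matches the next coefficient, so the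
  -- difference has degree below `m` and `m` distinct zeros.
  have hdeg : (q - p).degree < m := by
    rw [Polynomial.degree_lt_iff_coeff_zero]
    intro k hk
    rw [coeff_sub, sub_eq_zero]
    rcases hk.eq_or_lt with rfl | hk
    · exact hcoeff
    rcases (Nat.succ_le_of_lt hk).eq_or_lt with rfl | hk
    · have e1 := hqm.coeff_natDegree
      have e2 := hpm.coeff_natDegree
      rw [hqd] at e1
      rw [hpd] at e2
      exact e1.trans e2.symm
    · rw [coeff_eq_zero_of_natDegree_lt (by omega), coeff_eq_zero_of_natDegree_lt (by omega)]
  have hz := Polynomial.eq_zero_of_degree_lt_of_eval_index_eq_zero Finset.univ (v := μ m)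
    ((hμ.distinct m (Nat.le_of_succ_le hm)).injOn) (f := q - p) (by simpa using hdeg)
    (fun l _ => by simp [heval l])
  exact sub_eq_zero.1 hz

/-! ### The Hessenberg point of the fibre -/

lemma IsGeneric.mono {k n : ℕ} (hμ : IsGeneric n μ) (h : k ≤ n) : IsGeneric k μ :=
  ⟨fun m hm => hμ.distinct m (hm.trans h), fun m hm => hμ.disjoint m (hm.trans h)⟩

/-- The fibre contains a matrix all of whose arrow coordinates are `1`. -/
lemma exists_forall_isArrowCoord_one : ∀ {n : ℕ}, IsGeneric n μ →
    ∃ x ∈ fibre n μ, ∀ m : Fin n, IsArrowCoord μ x m fun _ => 1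
  | 0, _ => ⟨0, fun m hm => by
      obtain rfl : m = 0 := Nat.le_zero.1 hm
      exact E_of_charpoly (by simp [Matrix.charpoly]), fun m => m.elim0⟩
  | k + 1, hμ => by
    obtain ⟨x, hx, hs⟩ := exists_forall_isArrowCoord_one (hμ.mono (Nat.le_succ k))
    obtain ⟨g, hg⟩ := exists_isEigenFrame (hμ.mono (Nat.le_succ k)) hx le_rfl
    rw [leading_self] at hg
    obtain ⟨c, δ, hcp⟩ := exists_arrow hμ le_rfl (fun _ => 1) fun _ => one_ne_zero
    let y : M (k + 1) := bordered g 0 0 1 * bordered (diagonal (μ k)) c (fun _ => 1) δ *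
      bordered g⁻¹ 0 0 1
    have hy : leading y k (Nat.le_succ k) = x := by
      simp only [y, bordered_mul_mul, leading_bordered]
      exact hg.2.1.symm
    have hlead : ∀ m (hm : m ≤ k), leading y m (hm.trans (Nat.le_succ k)) = leading x m hm :=
      fun m hm => by rw [← hy, leading_leading]
    refine ⟨y, fun m hm => ?_, fun m => ?_⟩
    · rcases hm.eq_or_lt with rfl | hm
      · exact E_of_charpoly ((charpoly_conj (bordered_mul_bordered_eq_one hg.inv_mul) _).trans hcp)
      · rw [hlead m (Nat.le_of_lt_succ hm)]
        exact hx m _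
    · induction m using Fin.lastCases with
      | last => exact ⟨g, by simpa only [Fin.val_last, hy] using hg, c, δ, rfl⟩
      | cast m =>
        obtain ⟨g', hg', c', δ', e⟩ := hs m
        refine ⟨g', ?_, c', δ', ?_⟩
        · rw [← hlead m m.isLt.le] at hg'
          exact hg'
        · rw [← hlead (m + 1) m.isLt] at e
          exact e

/-- Among the matrices of the fibre, the unit upper Hessenberg ones are those all of whose arrow
coordinates are `1`. -/
lemma isUnitUpperHessenberg_iff (hμ : IsGeneric n μ) {x : M n} (hx : x ∈ fibre n μ) :
    IsUnitUpperHessenberg x ↔ ∀ m, IsArrowCoord μ x m fun _ => 1 := by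
  have h1 : ∀ m : Fin n, IsArrowCoord μ x m (fun _ => 1) ↔
      ∀ i, lastRow x m i = if (i : ℕ) + 1 = m then 1 else 0 := by
    intro m
    obtain ⟨g, hg⟩ := exists_isEigenFrame hμ hx m.isLt.le
    -- The last unit row times `g` is the last row of `g`, which consists of ones; since `g` is
    -- invertible, no other row is sent there.
    have he : (fun i : Fin m => if (i : ℕ) + 1 = m then (1 : ℂ) else 0) ᵥ* g = fun _ => 1 := by
      ext l
      let i₀ : Fin m := ⟨m - 1, by have := l.isLt; omega⟩
      have hi₀ : (i₀ : ℕ) + 1 = m := by have := l.isLt; simp only [i₀]; omega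
      rw [Matrix.vecMul, dotProduct, Finset.sum_eq_single i₀ _ (by simp), if_pos hi₀,
        hg.2.2 i₀ hi₀, one_mul]
      intro j _ hj
      rw [if_neg (fun e => hj (Fin.ext (by omega))), zero_mul]
    rw [isArrowCoord_iff hμ hg, ← he, (Matrix.vecMul_injective_iff_isUnit.2 hg.1).eq_iff,
      eq_comm, funext_iff]
  simp only [h1]
  constructor
  · rintro ⟨ha, hb⟩ m i
    split_ifs with h
    · exact hb _ _ (by simpa using h.symm)
    · have := i.isLt
      exact ha _ _ (by simp only [Fin.val_castLE]; omega)
  · intro h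
    constructor
    · intro i j hij
      have := h i ⟨j, by omega⟩
      rwa [if_neg (by simp only; omega)] at this
    · intro i j hij
      have := h i ⟨j, by omega⟩
      rwa [if_pos (by simp only; omega)] at this

end Frames

attribute [local instance] Matrix.normedAddCommGroup Matrix.normedSpace

/-! ### The derivative of a simple eigenvalue -/

section Branch

/-- The determinant as a continuous multilinear function of the rows. -/
def detMultilinear (m : ℕ) : ContinuousMultilinearMap ℂ (fun _ : Fin m => Fin m → ℂ) ℂ where
  toMultilinearMap := (Matrix.detRowAlternating (n := Fin m) (R := ℂ)).toMultilinearMap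
  cont := Continuous.matrix_det (A := fun A : Matrix (Fin m) (Fin m) ℂ => A) continuous_id

/-- The linear form `B ↦ tr (A B)`. -/
def traceMulL {m : ℕ} (A : M m) : M m →L[ℂ] ℂ :=
  LinearMap.toContinuousLinearMap (Matrix.traceLinearMap (Fin m) ℂ ℂ ∘ₗ LinearMap.mulLeft ℂ A)

@[simp] lemma traceMulL_apply {m : ℕ} (A B : M m) : traceMulL A B = (A * B).trace := rfl

/-- Jacobi's formula: differentiate row by row and expand each determinant by cofactors. -/
lemma hasFDerivAt_det {m : ℕ} (A : M m) :
    HasFDerivAt (fun B : M m => B.det) (traceMulL A.adjugate) A := by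
  have h : HasFDerivAt (fun B : M m => B.det) ((detMultilinear m).linearDeriv A) A :=
    (detMultilinear m).hasFDerivAt A
  refine h.congr_fderiv (ContinuousLinearMap.ext fun B : M m => ?_)
  have h1 : ((detMultilinear m).linearDeriv A) B = ∑ i, (A.updateRow i (B i)).det :=
    (detMultilinear m).linearDeriv_apply A B
  have h2 : ∀ i, (A.updateRow i (B i)).det = ∑ k, B i k * A.adjugate k i := by
    intro i
    rw [← Matrix.cramer_transpose_apply, Matrix.cramer_eq_adjugate_mulVec,
      ← Matrix.adjugate_transpose]
    simp [Matrix.mulVec, dotProduct, mul_comm]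
  refine h1.trans ?_
  change _ = (A.adjugate * B).trace
  rw [Matrix.trace_mul_comm]
  simp only [h2]
  rfl

lemma contDiff_det (m : ℕ) : ContDiff ℂ ⊤ fun B : M m => B.det :=
  (detMultilinear m).contDiff

variable {n : ℕ}

/-- The linear map `(z, w) ↦ w - z_m`. -/
def resolventL {m : ℕ} (h : m ≤ n) : M n × ℂ →L[ℂ] M m :=
  LinearMap.toContinuousLinearMap
    { toFun := fun p => p.2 • (1 : M m) - leading p.1 m h
      map_add' := fun p q => by
        ext i j; simp [leading, Matrix.one_apply]; split_ifs <;> ring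
      map_smul' := fun a p => by
        ext i j; simp [leading, Matrix.one_apply]; split_ifs <;> ring }

@[simp] lemma resolventL_apply {m : ℕ} (h : m ≤ n) (p : M n × ℂ) :
    resolventL h p = p.2 • (1 : M m) - leading p.1 m h := rfl

lemma isRoot_charpoly_iff {m : ℕ} (h : m ≤ n) (z : M n) (w : ℂ) :
    (leading z m h).charpoly.IsRoot w ↔ (resolventL h (z, w)).det = 0 := by
  rw [Polynomial.IsRoot, Matrix.eval_charpoly, resolventL_apply, Matrix.smul_one_eq_diagonal]
  rfl

lemma hasFDerivAt_det_resolventL {m : ℕ} (h : m ≤ n) (p : M n × ℂ) :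
    HasFDerivAt (fun q => (resolventL h q).det)
      (traceMulL (resolventL h p).adjugate ∘L resolventL h) p :=
  (hasFDerivAt_det (resolventL h p)).comp p (resolventL h).hasFDerivAt

/-- The adjugate of `λ_l - X` is a nonzero multiple of the spectral projection. -/
lemma IsEigenFrame.adjugate {m : ℕ} {X : M m} {lam : Fin m → ℂ} {g : M m}
    (hg : IsEigenFrame X lam g) (l : Fin m) :
    (lam l • (1 : M m) - X).adjugate =
      (∏ k ∈ Finset.univ.erase l, (lam l - lam k)) • frameProj g l := by
  have h1 : lam l • (1 : M m) - X = g * diagonal (fun k => lam l - lam k) * g⁻¹ := by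
    have : (diagonal fun k => lam l - lam k) = lam l • (1 : M m) - diagonal lam := by
      rw [Matrix.smul_one_eq_diagonal, Matrix.diagonal_sub]
    rw [this, Matrix.mul_sub, Matrix.sub_mul, ← hg.2.1, Matrix.mul_smul, Matrix.mul_one,
      Matrix.smul_mul, hg.mul_inv]
  have h2 : (diagonal fun k => lam l - lam k).adjugate =
      (∏ k ∈ Finset.univ.erase l, (lam l - lam k)) • (single l l 1 : M m) := by
    rw [Matrix.adjugate_diagonal]
    ext i j
    by_cases hij : i = j
    · subst hij
      by_cases hl : l = i
      · subst hl; simp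
      · rw [Matrix.diagonal_apply_eq, Finset.prod_eq_zero
          (Finset.mem_erase.2 ⟨hl, Finset.mem_univ l⟩) (sub_self _)]
        simp [hl]
    · have : ¬(l = i ∧ l = j) := fun h => hij (h.1.symm.trans h.2)
      simp [hij, this]
  have hadj : ∀ A : M m, IsUnit A.det → A.adjugate = A.det • A⁻¹ := fun A hA => by
    rw [Matrix.inv_def, smul_smul, Ring.mul_inverse_cancel _ hA, one_smul]
  have h3 : g⁻¹.adjugate = g.det⁻¹ • g := by
    rw [hadj _ (Matrix.isUnit_nonsing_inv_det g hg.det), Matrix.det_nonsing_inv,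
      Matrix.nonsing_inv_nonsing_inv _ hg.det, Ring.inverse_eq_inv]
  have h4 : g.adjugate = g.det • g⁻¹ := hadj g hg.det
  rw [h1, Matrix.adjugate_mul_distrib, Matrix.adjugate_mul_distrib, h2, h3, h4, frameProj]
  simp only [Matrix.smul_mul, Matrix.mul_smul, Matrix.mul_assoc, smul_smul]
  congr 1
  have := hg.det.ne_zero
  field_simp

lemma IsEigenFrame.trace_frameProj {m : ℕ} {X : M m} {lam : Fin m → ℂ} {g : M m}
    (hg : IsEigenFrame X lam g) (l : Fin m) : (frameProj g l).trace = 1 := by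
  rw [frameProj, Matrix.mul_assoc, Matrix.trace_mul_comm, Matrix.mul_assoc, hg.inv_mul]
  simp

variable {μ : (m : ℕ) → Fin m → ℂ}

/-- Implicit function theorem for `det (w - z_m) = 0`: the `w`-derivative at `(x, lam l)` is the
trace of the adjugate, namely `∏ (lam l - lam k)` over `k ≠ l`, nonzero for a simple eigenvalue. -/
lemma exists_isRitzBranch {x : M n} {m : ℕ} {h : m ≤ n} {lam : Fin m → ℂ}
    (hl : Function.Injective lam) {g : M m} (hg : IsEigenFrame (leading x m h) lam g) (l : Fin m) :
    ∃ ρ, IsRitzBranch x m h (lam l) ρ := by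
  let f : M n × ℂ → ℂ := fun q => (resolventL h q).det
  have hf : ContDiffAt ℂ ⊤ f (x, lam l) :=
    ((contDiff_det m).comp (resolventL h).contDiff).contDiffAt
  have hadj := hg.adjugate l
  have h0 := prod_erase_sub_ne_zero hl l
  set d := ∏ k ∈ Finset.univ.erase l, (lam l - lam k) with hd
  have hf' : fderiv ℂ f (x, lam l) ∘L .inr ℂ (M n) ℂ =
      ((ContinuousLinearEquiv.unitsEquivAut ℂ (Units.mk0 d h0) : ℂ ≃L[ℂ] ℂ) : ℂ →L[ℂ] ℂ) := by
    rw [(hasFDerivAt_det_resolventL h (x, lam l)).fderiv]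
    ext
    simp only [ContinuousLinearMap.comp_apply, ContinuousLinearMap.inr_apply, traceMulL_apply,
      resolventL_apply, hadj]
    simp [hg.trace_frameProj, leading]
  have hinv : (fderiv ℂ f (x, lam l) ∘L .inr ℂ (M n) ℂ).IsInvertible := ⟨_, hf'.symm⟩
  -- In `WithTop ℕ∞` the top element stands for analyticity, which the implicit function inherits.
  have htop : (⊤ : WithTop ℕ∞) ≠ 0 := by simp
  refine ⟨hf.implicitFunction htop hinv, ?_, hf.implicitFunction_apply_self htop hinv, ?_⟩
  · exact (hf.contDiffAt_implicitFunction htop hinv).analyticAt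
  · filter_upwards [hf.eventually_apply_implicitFunction htop hinv] with z hz
    rw [isRoot_charpoly_iff]
    refine hz.trans ?_
    rw [← isRoot_charpoly_iff]
    rw [hg.2.1, charpoly_conj hg.inv_mul, Matrix.charpoly_diagonal, Polynomial.IsRoot, eval_prod]
    exact Finset.prod_eq_zero (Finset.mem_univ l) (by simp)

/-- Differentiating `det (ρ z - z_m) = 0` in direction `Z` gives `tr (adj * (dρ(Z) - Z_m)) = 0`,
where the adjugate is a nonzero multiple of a projection of trace `1`. -/
lemma IsRitzBranch.fderiv_apply {x : M n} {m : ℕ} {h : m ≤ n} {lam : Fin m → ℂ}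
    (hl : Function.Injective lam) {g : M m} (hg : IsEigenFrame (leading x m h) lam g) {l : Fin m}
    {ρ : M n → ℂ} (hρ : IsRitzBranch x m h (lam l) ρ) (Z : M n) :
    fderiv ℂ ρ x Z = (pad h (frameProj g l) * Z).trace := by
  obtain ⟨ha, hx, hroot⟩ := hρ
  have h1 : HasFDerivAt (fun z => (z, ρ z)) ((ContinuousLinearMap.id ℂ (M n)).prod (fderiv ℂ ρ x))
      x := (hasFDerivAt_id x).prodMk ha.differentiableAt.hasFDerivAt
  have h2 := (hasFDerivAt_det_resolventL h (x, ρ x)).comp x h1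
  have h3 : HasFDerivAt ((fun q => (resolventL h q).det) ∘ fun z => (z, ρ z))
      (0 : M n →L[ℂ] ℂ) x := by
    refine (hasFDerivAt_const (0 : ℂ) x).congr_of_eventuallyEq ?_
    filter_upwards [hroot] with z hz
    exact (isRoot_charpoly_iff h z _).1 hz
  have h4 : ((resolventL h (x, ρ x)).adjugate *
      (fderiv ℂ ρ x Z • (1 : M m) - leading Z m h)).trace = 0 :=
    DFunLike.congr_fun (h2.unique h3) Z
  have h0 := prod_erase_sub_ne_zero hl l
  simp only [resolventL_apply, hx, hg.adjugate l, Matrix.smul_mul, Matrix.mul_sub, Matrix.mul_smul,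
    Matrix.trace_smul, Matrix.trace_sub, hg.trace_frameProj, smul_eq_mul,
    mul_one, sub_eq_zero] at h4
  rw [trace_pad_mul]
  exact mul_right_cancel₀ h0 (h4.trans (mul_comm _ _))

/-- For the trace form, this Lie–Poisson structure sends a gradient `G` to the commutator `[G, x]`.
-/
lemma hamiltonianField_eq {H : M n → ℂ} {x G : M n}
    (hG : ∀ Z, fderiv ℂ H x Z = (G * Z).trace) : hamiltonianField H x = G * x - x * G := by
  have h1 : ∀ i j, partialDeriv H i j x = G j i := by
    intro i j
    rw [partialDeriv, hG, Matrix.trace_mul_single]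
    simp
  have h2 : ∀ k l i j, partialDeriv (fun z : M n => z k l) i j x =
      if i = k ∧ j = l then 1 else 0 := by
    intro k l i j
    let ev : M n →L[ℂ] ℂ := LinearMap.toContinuousLinearMap (Matrix.entryLinearMap ℂ ℂ k l)
    have : fderiv ℂ (fun z : M n => z k l) x = ev := ev.hasFDerivAt.fderiv
    rw [partialDeriv, this]
    exact Matrix.single_apply ..
  ext k l
  simp only [hamiltonianField, poissonBracket, Matrix.of_apply, h1, h2, ite_and, mul_ite, mul_one,
    mul_zero, Finset.sum_ite_irrel, Finset.sum_ite_eq', Finset.mem_univ, if_true,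
    Finset.sum_const_zero, coordBracket, sub_mul, Finset.sum_sub_distrib, Matrix.sub_apply,
    Matrix.mul_apply, ite_mul, zero_mul]
  simp only [mul_comm]

/-- The arbitrary choice of branch is harmless, as every branch has the same derivative at `x`. -/
lemma ritzField_eq (hμ : IsGeneric n μ) {x : M n} {m : Fin n} {g : M m}
    (hg : IsEigenFrame (leading x m m.isLt.le) (μ m) g) (l : Fin m) :
    ritzField μ m l x =
      pad m.isLt.le (frameProj g l) * x - x * pad m.isLt.le (frameProj g l) := by
  have hl := hμ.distinct m m.isLt.le
  exact hamiltonianField_eq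
    ((Classical.epsilon_spec (exists_isRitzBranch hl hg l)).fderiv_apply hl hg)

end Branch

/-! ### The flows -/

section Flow

variable {n : ℕ} {μ : (m : ℕ) → Fin m → ℂ}

lemma hasDerivAt_matrix_iff {φ : ℂ → M n} {φ' : M n} {t : ℂ} :
    HasDerivAt φ φ' t ↔ ∀ i j, HasDerivAt (fun t => φ t i j) (φ' i j) t := by
  have h1 : HasDerivAt φ φ' t ↔ ∀ i, HasDerivAt (fun t => φ t i) (φ' i) t :=
    hasDerivAt_pi (φ := φ) (φ' := φ')
  rw [h1]
  exact forall_congr' fun i => hasDerivAt_pi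

lemma HasDerivAt.matrix_mul {φ ψ : ℂ → M n} {φ' ψ' : M n} {t : ℂ} (h : HasDerivAt φ φ' t)
    (h' : HasDerivAt ψ ψ' t) :
    HasDerivAt (fun t => φ t * ψ t) (φ' * ψ t + φ t * ψ') t := by
  rw [hasDerivAt_matrix_iff] at h h' ⊢
  intro i j
  simp only [Matrix.mul_apply, Matrix.add_apply, ← Finset.sum_add_distrib]
  exact HasDerivAt.fun_sum fun k _ => (h i k).mul (h' k j)

lemma hasDerivAt_dil {a : ℂ → ℂ} {a' t : ℂ} (P : M n) (h : HasDerivAt a a' t) :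
    HasDerivAt (fun t => dil (a t) P) (a' • P) t :=
  ((h.sub_const 1).smul_const P).const_add 1

/-- The conjugation of `x` by `exp (t P)`, for an idempotent `P` extended by zeros. -/
def conjFlow {m : ℕ} (h : m ≤ n) (P : M m) (t : ℂ) (x : M n) : M n :=
  dil (Complex.exp t) (pad h P) * x * dil (Complex.exp (-t)) (pad h P)

lemma dil_exp_mul_dil_exp_neg {P : M n} (hP : P * P = P) (t : ℂ) :
    dil (Complex.exp t) P * dil (Complex.exp (-t)) P = 1 := by
  rw [dil_mul_dil _ _ hP, ← Complex.exp_add, add_neg_cancel, Complex.exp_zero, dil_one]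

lemma dil_exp_neg_mul_dil_exp {P : M n} (hP : P * P = P) (t : ℂ) :
    dil (Complex.exp (-t)) P * dil (Complex.exp t) P = 1 := by
  rw [dil_mul_dil _ _ hP, ← Complex.exp_add, neg_add_cancel, Complex.exp_zero, dil_one]

lemma hasDerivAt_conjFlow {m : ℕ} (h : m ≤ n) {P : M m} (hP : P * P = P) (t : ℂ) (x : M n) :
    HasDerivAt (fun t => conjFlow h P t x)
      (pad h P * conjFlow h P t x - conjFlow h P t x * pad h P) t := by
  have hP' : pad h P * pad h P = pad h P := by rw [pad_mul_pad, hP]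
  have h1 := hasDerivAt_dil (pad h P) (Complex.hasDerivAt_exp t)
  have h2 := hasDerivAt_dil (pad h P) ((hasDerivAt_neg t).cexp)
  have h3 := HasDerivAt.matrix_mul (HasDerivAt.matrix_mul h1 (hasDerivAt_const t x)) h2
  refine h3.congr_deriv ?_
  symm
  rw [conjFlow, ← Matrix.mul_assoc, ← Matrix.mul_assoc, Matrix.mul_assoc _ _ (pad h P),
    self_mul_dil _ hP', dil_mul_self _ hP']
  simp [sub_eq_add_neg]

/-- A curve with `φ' = [P, φ]`, for a constant idempotent `P`, is a conjugation flow. -/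
lemma eq_conjFlow {m : ℕ} (h : m ≤ n) {P : M m} (hP : P * P = P) {φ : ℂ → M n}
    (hφ : ∀ t, HasDerivAt φ (pad h P * φ t - φ t * pad h P) t) (t : ℂ) :
    φ t = conjFlow h P t (φ 0) := by
  have hP' : pad h P * pad h P = pad h P := by rw [pad_mul_pad, hP]
  set Q := pad h P
  -- Undoing the conjugation leaves a curve with zero derivative.
  let ψ : ℂ → M n := fun t => dil (Complex.exp (-t)) Q * φ t * dil (Complex.exp t) Q
  have hψ : ∀ t, HasDerivAt ψ 0 t := by
    intro t
    have h1 := hasDerivAt_dil Q (Complex.hasDerivAt_exp t)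
    have h2 := hasDerivAt_dil Q ((hasDerivAt_neg t).cexp)
    have h3 := HasDerivAt.matrix_mul (HasDerivAt.matrix_mul h2 (hφ t)) h1
    refine h3.congr_deriv ?_
    have e1 : dil (Complex.exp (-t)) Q * (Q * φ t - φ t * Q) * dil (Complex.exp t) Q =
        (dil (Complex.exp (-t)) Q * Q) * φ t * dil (Complex.exp t) Q -
          dil (Complex.exp (-t)) Q * φ t * (Q * dil (Complex.exp t) Q) := by
      simp only [Matrix.mul_sub, Matrix.sub_mul, Matrix.mul_assoc]
    rw [Matrix.add_mul, e1, dil_mul_self _ hP', self_mul_dil _ hP']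
    simp only [mul_neg_one, neg_smul, Matrix.neg_mul, Matrix.smul_mul, Matrix.mul_smul]
    abel
  have hc : ψ t = ψ 0 :=
    is_const_of_deriv_eq_zero (fun t => (hψ t).differentiableAt) (fun t => (hψ t).deriv) t 0
  have hc0 : ψ 0 = φ 0 := by simp [ψ, dil_one]
  calc φ t = (dil (Complex.exp t) Q * dil (Complex.exp (-t)) Q) * φ t *
        (dil (Complex.exp t) Q * dil (Complex.exp (-t)) Q) := by
        rw [dil_exp_mul_dil_exp_neg hP', Matrix.one_mul, Matrix.mul_one]
    _ = dil (Complex.exp t) Q * ψ t * dil (Complex.exp (-t)) Q := by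
        simp only [ψ, Matrix.mul_assoc]
    _ = conjFlow h P t (φ 0) := by rw [hc, hc0]; rfl

lemma leading_conjFlow_of_le {m k : ℕ} (h : m ≤ k) (h' : k ≤ n) (P : M m) (t : ℂ) (x : M n) :
    leading (conjFlow (h.trans h') P t x) k h' = conjFlow h P t (leading x k h') :=
  leading_dil_mul_dil h h' _ _ P x

lemma leading_conjFlow {m : ℕ} (h : m ≤ n) {P : M m} (hP : P * P = P) {x : M n}
    (hc : Commute P (leading x m h)) (t : ℂ) :
    leading (conjFlow h P t x) m h = leading x m h := by
  rw [leading_conjFlow_of_le le_rfl h, conjFlow, pad_refl, (dil_commute _ hc).eq,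
    Matrix.mul_assoc, dil_exp_mul_dil_exp_neg hP, Matrix.mul_one]

/-- The submatrices of order at most `m` do not move; the larger ones are conjugated. -/
lemma conjFlow_mem_fibre {m : ℕ} (h : m ≤ n) {P : M m} (hP : P * P = P) {x : M n}
    (hx : x ∈ fibre n μ) (hc : Commute P (leading x m h)) (t : ℂ) :
    conjFlow h P t x ∈ fibre n μ := by
  intro k hk
  rw [← hx k hk]
  rcases le_total k m with hkm | hkm
  · rw [← leading_leading hkm h, leading_conjFlow h hP hc, leading_leading]
  · rw [leading_conjFlow_of_le hkm hk, E, conjFlow,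
      charpoly_conj (dil_exp_neg_mul_dil_exp (by rw [pad_mul_pad, hP]) t), E]

lemma isIntegralCurve_conjFlow (hμ : IsGeneric n μ) {x : M n} (hx : x ∈ fibre n μ) {m : Fin n}
    {g : M m} (hg : IsEigenFrame (leading x m m.isLt.le) (μ m) g) (l : Fin m) :
    IsIntegralCurve μ m l x fun t => conjFlow m.isLt.le (frameProj g l) t x := by
  have hP := hg.frameProj_mul_self l
  have hc := hg.commute_frameProj l
  refine ⟨by simp [conjFlow, dil_one], fun t => ⟨conjFlow_mem_fibre _ hP hx hc t, ?_⟩⟩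
  rw [ritzField_eq hμ (by rwa [leading_conjFlow _ hP hc]) l]
  exact hasDerivAt_conjFlow _ hP t x

/-- A priori the projection varies with `φ t`. But it commutes with the leading submatrix of order
`m`, whose derivative therefore vanishes; the projection is then constant and the equation becomes
linear with constant coefficients. -/
lemma IsIntegralCurve.eq_conjFlow (hμ : IsGeneric n μ) {x : M n} {m : Fin n} {g : M m}
    (hg : IsEigenFrame (leading x m m.isLt.le) (μ m) g) {l : Fin m} {φ : ℂ → M n}
    (hφ : IsIntegralCurve μ m l x φ) (t : ℂ) :
    φ t = conjFlow m.isLt.le (frameProj g l) t x := by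
  obtain ⟨h0, hφ⟩ := hφ
  have hlead : ∀ t, leading (φ t) m m.isLt.le = leading x m m.isLt.le := by
    have hd : ∀ t, HasDerivAt (fun t => leading (φ t) m m.isLt.le) 0 t := by
      intro t
      obtain ⟨gt, hgt⟩ := exists_isEigenFrame hμ (hφ t).1 m.isLt.le
      have h1 := (hφ t).2
      rw [ritzField_eq hμ hgt l, hasDerivAt_matrix_iff] at h1
      have h2 : leading (pad m.isLt.le (frameProj gt l) * φ t -
          φ t * pad m.isLt.le (frameProj gt l)) m m.isLt.le = 0 := by
        have e := (hgt.commute_frameProj l).eq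
        rw [leading_eq, Matrix.mul_sub, Matrix.sub_mul, ← Matrix.mul_assoc,
          incl_mul_pad le_rfl m.isLt.le, pad_refl, Matrix.mul_assoc, Matrix.mul_assoc,
          Matrix.mul_assoc, Matrix.mul_assoc,
          pad_mul_incl_transpose le_rfl m.isLt.le, pad_refl, ← Matrix.mul_assoc (incl _),
          ← Matrix.mul_assoc (φ t), ← Matrix.mul_assoc (incl _), ← Matrix.mul_assoc (incl _),
          ← leading_eq, e, sub_self]
      rw [hasDerivAt_matrix_iff]
      intro i j
      rw [← h2]
      exact h1 _ _
    intro t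
    have := is_const_of_deriv_eq_zero (fun t => (hd t).differentiableAt) (fun t => (hd t).deriv) t 0
    simpa [h0] using this
  rw [← h0]
  refine GZ.eq_conjFlow m.isLt.le (hg.frameProj_mul_self l) (fun t => ?_) t
  rw [← ritzField_eq hμ (by rwa [hlead t]) l]
  exact (hφ t).2

lemma existsUnique_isIntegralCurve (hμ : IsGeneric n μ) {x : M n} (hx : x ∈ fibre n μ) (m : Fin n)
    (l : Fin m) : ∃! φ, IsIntegralCurve μ m l x φ := by
  obtain ⟨g, hg⟩ := exists_isEigenFrame hμ hx m.isLt.le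
  exact ⟨_, isIntegralCurve_conjFlow hμ hx hg l, fun φ hφ => funext (hφ.eq_conjFlow hμ hg)⟩

lemma flow_eq_conjFlow (hμ : IsGeneric n μ) {x : M n} (hx : x ∈ fibre n μ) {m : Fin n}
    {g : M m} (hg : IsEigenFrame (leading x m m.isLt.le) (μ m) g) (l : Fin m) (t : ℂ) :
    flow μ m l t x = conjFlow m.isLt.le (frameProj g l) t x :=
  (Classical.epsilon_spec (existsUnique_isIntegralCurve hμ hx m l).exists).eq_conjFlow hμ hg t

lemma flow_mem_fibre (hμ : IsGeneric n μ) {x : M n} (hx : x ∈ fibre n μ) (m : Fin n)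
    (l : Fin m) (t : ℂ) : flow μ m l t x ∈ fibre n μ :=
  ((Classical.epsilon_spec (existsUnique_isIntegralCurve hμ hx m l).exists).2 t).1

/-! ### The flows in arrow coordinates -/

lemma lastRow_eq (x : M n) (k : Fin n) :
    lastRow x k = fun j => (x * (incl k.isLt.le)ᵀ) k j := by
  rw [mul_incl_transpose]; rfl

lemma lastRow_conjFlow {m : ℕ} {k : Fin n} (h : m ≤ k) (P : M m) (t : ℂ) (x : M n) :
    lastRow (conjFlow (h.trans k.isLt.le) P t x) k =
      lastRow x k ᵥ* dil (Complex.exp (-t)) (pad h P) := by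
  ext j
  rw [lastRow_eq, conjFlow]
  change (_ * _ : Matrix (Fin n) (Fin k) ℂ) k j = _
  rw [Matrix.mul_assoc, Matrix.mul_assoc,
    dil_pad_mul_apply_of_le _ _ _ _ _ _ h, dil_mul_incl_transpose h k.isLt.le, ← Matrix.mul_assoc,
    lastRow_eq]
  rfl

/-- The flow of the Ritz value `μ^{(m)}_l` multiplies the arrow coordinate `(m, l)` by `e^{-t}` and
fixes the other ones. -/
lemma isArrowCoord_flow (hμ : IsGeneric n μ) {x : M n} (hx : x ∈ fibre n μ) (m : Fin n) (l : Fin m)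
    (t : ℂ) {s : (m : Fin n) → Fin m → ℂ} (hs : ∀ k, IsArrowCoord μ x k (s k)) (k : Fin n) :
    IsArrowCoord μ (flow μ m l t x) k fun j =>
      if (⟨k, j⟩ : Σ m : Fin n, Fin m) = ⟨m, l⟩ then Complex.exp (-t) * s k j else s k j := by
  obtain ⟨g, hg⟩ := exists_isEigenFrame hμ hx m.isLt.le
  have hP := hg.frameProj_mul_self l
  have hc := hg.commute_frameProj l
  rw [flow_eq_conjFlow hμ hx hg]
  rcases lt_trichotomy k m with hkm | rfl | hkm
  -- Level `k < m`: `x_{k+1}` lies inside the fixed block `x_m`.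
  · have hne : ∀ j : Fin k, (⟨k, j⟩ : Σ m : Fin n, Fin m) ≠ ⟨m, l⟩ := fun j e =>
      hkm.ne (congrArg Sigma.fst e)
    simp only [hne, if_false]
    have e : leading (conjFlow m.isLt.le (frameProj g l) t x) (k + 1) k.isLt =
        leading x (k + 1) k.isLt := by
      rw [← leading_leading (Nat.succ_le_of_lt hkm) m.isLt.le, leading_conjFlow _ hP hc]
      rfl
    obtain ⟨g', hg', c, δ, h⟩ := hs k
    refine ⟨g', ?_, c, δ, e.trans h⟩
    rwa [← leading_leading (Nat.le_succ k) k.isLt, e, leading_leading]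
  -- Same level: the frame is fixed and the row is multiplied by the inverse dilation, which the
  -- frame turns into scaling of the entry `l`.
  · have hb := (isArrowCoord_iff hμ hg _).1 (hs k)
    rw [isArrowCoord_iff hμ (by rwa [leading_conjFlow _ hP hc]), lastRow_conjFlow le_rfl, pad_refl,
      Matrix.vecMul_vecMul, dil, Matrix.add_mul, Matrix.one_mul, Matrix.smul_mul,
      hg.frameProj_mul_frame, Matrix.vecMul_add, Matrix.vecMul_smul, ← Matrix.vecMul_vecMul, ← hb]
    ext j
    have hv : (s k ᵥ* (single l l 1 : M k)) j = if j = l then s k j else 0 := by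
      by_cases hj : j = l
      · subst hj
        simp [Matrix.vecMul, dotProduct, Matrix.single_apply]
      · simp [Matrix.vecMul, dotProduct, hj, Ne.symm hj]
    rw [Pi.add_apply, Pi.smul_apply, hv]
    by_cases hj : j = l
    · subst hj
      simp
      ring
    · simp [hj]
  -- Level `k > m`: the new frame is `A * gk`. Its last row, of index `k - 1 ≥ m`, is untouched by
  -- `A`, and the factor `B` on the row of `x` cancels `A`.
  · have hne : ∀ j : Fin k, (⟨k, j⟩ : Σ m : Fin n, Fin m) ≠ ⟨m, l⟩ := fun j e =>
      hkm.ne (congrArg Sigma.fst e).symm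
    simp only [hne, if_false]
    have hle : (m : ℕ) ≤ k := hkm.le
    obtain ⟨gk, hgk, hb⟩ := (isArrowCoord_iff_exists x k (s k)).1 (hs k)
    have hP' : pad hle (frameProj g l) * pad hle (frameProj g l) = pad hle (frameProj g l) := by
      rw [pad_mul_pad, hP]
    have hAB := dil_exp_mul_dil_exp_neg hP' t
    have hBA := dil_exp_neg_mul_dil_exp hP' t
    set A := dil (Complex.exp t) (pad hle (frameProj g l)) with hA
    set B := dil (Complex.exp (-t)) (pad hle (frameProj g l))
    have hinv : (A * gk)⁻¹ = gk⁻¹ * B :=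
      Matrix.inv_eq_right_inv (by
        calc A * gk * (gk⁻¹ * B) = A * (gk * gk⁻¹) * B := by simp only [Matrix.mul_assoc]
          _ = 1 := by rw [hgk.mul_inv, Matrix.mul_one, hAB])
    refine (isArrowCoord_iff_exists _ k _).2 ⟨A * gk, ⟨?_, ?_, fun i hi j => ?_⟩, ?_⟩
    · exact IsUnit.mul ⟨⟨A, B, hAB, hBA⟩, rfl⟩ hgk.1
    · rw [hinv, leading_conjFlow_of_le hle k.isLt.le, conjFlow]
      conv_lhs => rw [hgk.2.1]
      simp only [Matrix.mul_assoc]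
      rfl
    · have : (m : ℕ) < k := hkm
      rw [hA, dil_pad_mul_apply_of_le _ _ _ _ _ _ (by omega), hgk.2.2 i hi]
    · rw [lastRow_conjFlow hle, Matrix.vecMul_vecMul, ← Matrix.mul_assoc]
      change s k = lastRow x k ᵥ* (B * A * gk)
      rw [hBA, Matrix.one_mul, hb]

/-! ### Products of flows and Kostant–Wallach coordinates -/

lemma act_eq_foldr (q : (m : Fin n) → Fin m → ℂ) (x : M n) :
    act μ q x = ((List.finRange n).sigma fun m => List.finRange m).foldr
      (fun p z => flow μ p.1 p.2 (q p.1 p.2) z) x := by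
  simp only [List.sigma, List.foldr_flatMap, List.foldr_map]
  rfl

/-- Induction on a flattened list of index pairs; absence of repetitions ensures that each
coordinate is scaled at most once. -/
lemma isArrowCoord_foldr_flow (hμ : IsGeneric n μ) {x : M n} (hx : x ∈ fibre n μ)
    {s : (m : Fin n) → Fin m → ℂ} (hs : ∀ k, IsArrowCoord μ x k (s k))
    (q : (m : Fin n) → Fin m → ℂ) (L : List (Σ m : Fin n, Fin m)) (hL : L.Nodup) :
    L.foldr (fun p z => flow μ p.1 p.2 (q p.1 p.2) z) x ∈ fibre n μ ∧
      ∀ k, IsArrowCoord μ (L.foldr (fun p z => flow μ p.1 p.2 (q p.1 p.2) z) x) k fun j =>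
        if (⟨k, j⟩ : Σ m : Fin n, Fin m) ∈ L then Complex.exp (-q k j) * s k j else s k j := by
  induction L with
  | nil => exact ⟨hx, by simpa using hs⟩
  | cons p L ih =>
    obtain ⟨hp, hL⟩ := List.nodup_cons.1 hL
    obtain ⟨h1, h2⟩ := ih hL
    refine ⟨flow_mem_fibre hμ h1 _ _ _, fun k => ?_⟩
    refine (congrArg (IsArrowCoord μ _ k) (funext fun j => ?_)).mp
      (isArrowCoord_flow hμ h1 p.1 p.2 (q p.1 p.2) h2 k)
    by_cases h : (⟨k, j⟩ : Σ m : Fin n, Fin m) = p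
    · subst h
      simp [hp]
    · simp [h]

lemma act_mem_fibre_and_isArrowCoord (hμ : IsGeneric n μ) {x : M n} (hx : x ∈ fibre n μ)
    {s : (m : Fin n) → Fin m → ℂ} (hs : ∀ k, IsArrowCoord μ x k (s k))
    (q : (m : Fin n) → Fin m → ℂ) :
    act μ q x ∈ fibre n μ ∧
      ∀ k, IsArrowCoord μ (act μ q x) k fun j => Complex.exp (-q k j) * s k j := by
  rw [act_eq_foldr]
  have := isArrowCoord_foldr_flow hμ hx hs q ((List.finRange n).sigma fun m => List.finRange m)
    ((List.nodup_finRange n).sigma fun m => List.nodup_finRange m)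
  simpa [List.mem_sigma] using this

lemma existsUnique_isUnitUpperHessenberg (hμ : IsGeneric n μ) :
    ∃! y : M n, y ∈ fibre n μ ∧ IsUnitUpperHessenberg y := by
  obtain ⟨y, hy, hs⟩ := exists_forall_isArrowCoord_one hμ
  refine ⟨y, ⟨hy, (isUnitUpperHessenberg_iff hμ hy).2 hs⟩, fun z hz => ?_⟩
  exact eq_of_isArrowCoord hμ hz.1 hy ((isUnitUpperHessenberg_iff hμ hz.1).1 hz.2) hs

lemma isKWCoord_iff (hμ : IsGeneric n μ) {x : M n} (hx : x ∈ fibre n μ)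
    (s : (m : Fin n) → Fin m → ℂ) : IsKWCoord μ x s ↔ ∀ m, IsArrowCoord μ x m (s m) := by
  constructor
  · rintro ⟨y, hy, hh, q, rfl, hs⟩ m
    have := (act_mem_fibre_and_isArrowCoord hμ hy ((isUnitUpperHessenberg_iff hμ hy).1 hh) q).2 m
    simp only [mul_one, ← hs] at this
    exact this
  · intro h
    obtain ⟨y, ⟨hy, hh⟩, -⟩ := existsUnique_isUnitUpperHessenberg hμ
    -- Arrow coordinates are nonzero, so logarithms supply the times `q`; any branch would do, since
    -- only `e^{-q}` matters.
    have hexp : ∀ m l, s m l = Complex.exp (- -Complex.log (s m l)) := fun m l => by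
      rw [neg_neg, Complex.exp_log ((h m).ne_zero hμ hx l)]
    obtain ⟨h1, h2⟩ := act_mem_fibre_and_isArrowCoord hμ hy
      ((isUnitUpperHessenberg_iff hμ hy).1 hh) (fun m l => -Complex.log (s m l))
    refine ⟨y, hy, hh, fun m l => -Complex.log (s m l), ?_, hexp⟩
    simp only [mul_one, ← hexp] at h2
    exact eq_of_isArrowCoord hμ hx h1 h h2

lemma existsUnique_isKWCoord (hμ : IsGeneric n μ) {x : M n} (hx : x ∈ fibre n μ) :
    ∃! s : (m : Fin n) → Fin m → ℂ, IsKWCoord μ x s := by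
  choose s hs using exists_isArrowCoord hμ hx
  refine ⟨s, (isKWCoord_iff hμ hx s).2 hs, fun s' hs' => ?_⟩
  exact funext fun m => ((isKWCoord_iff hμ hx s').1 hs' m).unique hμ (hs m)

end Flow

end

end GZ

theorem mainTheorem1 (n : ℕ) (μ : (m : ℕ) → Fin m → ℂ) (hμ : GZ.IsGeneric n μ) :
    -- the fibre contains exactly one unit upper Hessenberg matrix
    (∃! y : GZ.M n, y ∈ GZ.fibre n μ ∧ GZ.IsUnitUpperHessenberg y) ∧
    -- the flows exist for all complex times and are unique
    (∀ (m : Fin n) (l : Fin m), ∀ x ∈ GZ.fibre n μ, ∃! φ : ℂ → GZ.M n,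
      GZ.IsIntegralCurve μ m l x φ) ∧
    -- the Kostant–Wallach coordinates are well defined on the whole fibre
    (∀ x ∈ GZ.fibre n μ, ∃! s : (m : Fin n) → Fin m → ℂ, GZ.IsKWCoord μ x s) ∧
    -- and they are identical with the arrow coordinates
    (∀ x ∈ GZ.fibre n μ, ∀ s : (m : Fin n) → Fin m → ℂ,
      GZ.IsKWCoord μ x s ↔ ∀ m, GZ.IsArrowCoord μ x m (s m)) ∧
    -- concretely
    (∀ y ∈ GZ.fibre n μ, GZ.IsUnitUpperHessenberg y → ∀ q : (m : Fin n) → Fin m → ℂ,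
      ∀ x : GZ.M n, x = GZ.act μ (fun m l => -q m l) y →
        x ∈ GZ.fibre n μ ∧ ∀ m, GZ.IsArrowCoord μ x m (fun l => Complex.exp (q m l))) := by
  refine ⟨GZ.existsUnique_isUnitUpperHessenberg hμ,
    fun m l x hx => GZ.existsUnique_isIntegralCurve hμ hx m l,
    fun x hx => GZ.existsUnique_isKWCoord hμ hx, fun x hx s => GZ.isKWCoord_iff hμ hx s, ?_⟩
  rintro y hy hh q x rfl
  have := GZ.act_mem_fibre_and_isArrowCoord hμ hy ((GZ.isUnitUpperHessenberg_iff hμ hy).1 hh)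
    (fun m l => -q m l)
  simpa using this
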